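/- Let $F:\mathbb{R}^2\to\mathbb{R}^2$ be a $C^2$ vector field and let $D\subset\mathbb{R}^2$ be a domain (a nonempty connected open set) whose boundary $\partial D$ is a piecewise $C^1$ Jordan curve. For $x \in\mathbb{R}^2$ let $\omega(x)$ be the $\omega$-limit set of $x$, i.e. the set of all limit points, as $t\to\infty$, of the solution of $\dot y=F(y)$, $y(0)=x$. Assume that there is a point $x\in D$ with $\omega(x)=\partial D$. A strictly orthogonal Helmholtz--Hodge decomposition (HHD) of $F$ on $\overline D$ is a decomposition $F=-\nabla V+u$ on $\overline D$, where $V:\overline D\to\mathbb{R}$ is of class $C^3$, $u:\overline D\to\mathbb{R}^2$ is a vector field of class $C^2$ with $\nabla\cdot u=0$, and $u(y)\cdot\nabla V(y)=0$ for all $y\in\overline D$. Here a function is of class $C^k$ on $\overline D$ if it is continuous on $\overline D$, is of class $C^k$ in $D$, and all its derivatives of order at most $k$ extend continuously from $D$ to $\overline D$; derivatives on $\partial D$ are understood as these extensions. Then a strictly orthogonal HHD of $F$ on $\overline D$ is unique if it exists: if $F=-\nabla V_1+u_1$ and $F=-\nabla V_2+u_2$ are two strictly orthogonal HHDs of $F$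 on $\overline D$, then $u_1=u_2$ and $\nabla V_1=\nabla V_2$ on $\overline D$, and $V_1-V_2$ is constant on $\overline D$. -/

import Mathlib

open Set Filter Topology

noncomputable section

namespace PlanarHHD

/-- A set in the plane is a piecewise `C^1` Jordan curve if it is the image of a continuous closed
curve on `[0, 1]`, injective on `[0, 1)`, which is `C^1` (with one-sided derivatives at the end
points) on each closed interval of some partition `0 = t 0 < ⋯ < t m = 1`. -/
def IsPiecewiseC1JordanCurve (J : Set (EuclideanSpace ℝ (Fin 2))) : Prop :=
  ∃ γ : ℝ → EuclideanSpace ℝ (Fin 2),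
    ContinuousOn γ (Icc 0 1) ∧ γ 0 = γ 1 ∧ InjOn γ (Ico 0 1) ∧ γ '' Icc 0 1 = J ∧
    ∃ (m : ℕ) (t : Fin (m + 1) → ℝ), StrictMono t ∧ t 0 = 0 ∧ t (Fin.last m) = 1 ∧
      ∀ i : Fin m, ContDiffOn ℝ 1 γ (Icc (t i.castSucc) (t i.succ))

/-- The `ω`-limit set of `x` for `ẏ = F y`: all limit points, as time tends to infinity, of the
solution on `[0, ∞)` which starts at `x`. (For a `C^1` field that solution is unique if it exists;
if the solution blows up in finite time the set is empty.) -/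
def omegaLimitSet {n : ℕ} (F : EuclideanSpace ℝ (Fin n) → EuclideanSpace ℝ (Fin n))
    (x : EuclideanSpace ℝ (Fin n)) : Set (EuclideanSpace ℝ (Fin n)) :=
  {y | ∃ γ : ℝ → EuclideanSpace ℝ (Fin n), γ 0 = x ∧
    IsIntegralCurveOn γ (fun _ => F) (Ici 0) ∧ MapClusterPt y atTop γ}

/-- `f` is of class `C^k` on the closure of the open set `D`: it is `C^k` on `D`, continuous on the
closure of `D`, and all its derivatives of order at most `k` extend continuously from `D` to the
closure of `D`. -/
def IsCkOnClosure {E G : Type*} [NormedAddCommGroup E] [NormedSpace ℝ E] [NormedAddCommGroup G]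
    [NormedSpace ℝ G] (k : ℕ) (f : E → G) (D : Set E) : Prop :=
  ContDiffOn ℝ k f D ∧ ContinuousOn f (closure D) ∧
    ∀ m : ℕ, m ≤ k → ∃ g : E → ContinuousMultilinearMap ℝ (fun _ : Fin m => E) G,
      ContinuousOn g (closure D) ∧ ∀ x ∈ D, g x = iteratedFDeriv ℝ m f x

/-- The gradient of `V` on `D`, extended by continuity to the closure of `D`. -/
def gradOnClosure {n : ℕ} (D : Set (EuclideanSpace ℝ (Fin n)))
    (V : EuclideanSpace ℝ (Fin n) → ℝ) : EuclideanSpace ℝ (Fin n) → EuclideanSpace ℝ (Fin n) :=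
  extendFrom D (gradient V)

/-- The divergence `∑ i, ∂u i / ∂x i`. -/
def divergence {n : ℕ} (u : EuclideanSpace ℝ (Fin n) → EuclideanSpace ℝ (Fin n))
    (x : EuclideanSpace ℝ (Fin n)) : ℝ :=
  ∑ i : Fin n, fderiv ℝ u x (EuclideanSpace.single i 1) i

/-- `F = -∇V + u` is a Helmholtz--Hodge decomposition of `F` on the closure of the open set `D`:
the potential `V` is `C^3`, the vector field `u` is `C^2`, and `u` is divergence-free. (The
derivatives of `u` extend continuously to the closure of `D`, so vanishing of the divergence on `D`
is the same as vanishing on the closure.) -/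
structure IsHHDOnClosure {n : ℕ} (F : EuclideanSpace ℝ (Fin n) → EuclideanSpace ℝ (Fin n))
    (D : Set (EuclideanSpace ℝ (Fin n))) (V : EuclideanSpace ℝ (Fin n) → ℝ)
    (u : EuclideanSpace ℝ (Fin n) → EuclideanSpace ℝ (Fin n)) : Prop where
  potential_C3 : IsCkOnClosure 3 V D
  field_C2 : IsCkOnClosure 2 u D
  decomposition : ∀ x ∈ closure D, F x = -gradOnClosure D V x + u x
  divergence_free : ∀ x ∈ D, divergence u x = 0

/-- A strictly orthogonal Helmholtz--Hodge decomposition on the closure of `D`: `u · ∇V = 0` at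
every point of the closure. -/
structure IsStrictlyOrthogonalHHD {n : ℕ}
    (F : EuclideanSpace ℝ (Fin n) → EuclideanSpace ℝ (Fin n))
    (D : Set (EuclideanSpace ℝ (Fin n))) (V : EuclideanSpace ℝ (Fin n) → ℝ)
    (u : EuclideanSpace ℝ (Fin n) → EuclideanSpace ℝ (Fin n)) : Prop
    extends IsHHDOnClosure F D V u where
  orthogonal : ∀ x ∈ closure D, inner ℝ (u x) (gradOnClosure D V x) = 0

end PlanarHHD

end

/-! Along a trajectory in `D`, orthogonality gives `dV/dt = -‖∇V‖ ^ 2`. If the trajectory returns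
near `y` infinitely often, then `V` decreases along it to no less than `V y`; were `∇V` nonzero at
`y`, each close return would cost a fixed amount of `V`. So `∇V = 0` on the `ω`-limit set, here the
whole frontier (`gradOnClosure_eq_zero`). For two decompositions, `H = u₁ - u₂ = ∇(V₁ - V₂)` is thus
divergence-free, curl-free and zero on the frontier: `H₀ - i H₁` is holomorphic on `D`. Extended by
zero, it is Lipschitz at each point of the frontier, so its square is entire; the zeros accumulate
on the Jordan curve, and the identity theorem gives `H = 0`
(`eq_zero_of_divergence_eq_zero_of_symmetric`). Boundedness of `D` plays no role. -/

namespace PlanarHHD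

/-! ### Dependence on initial values, and trajectories confined to `D`. -/

/-- Integral curves of a `C^1` field depend Lipschitz continuously on the initial value. -/
theorem exists_dist_le_of_isIntegralCurveOn {E : Type*} [NormedAddCommGroup E] [NormedSpace ℝ E]
    [ProperSpace E] {v : E → E} (hv : ContDiff ℝ 1 v) {α : ℝ → E} {T : ℝ}
    (hα : IsIntegralCurveOn α (fun _ => v) (Icc 0 T)) :
    ∃ C > 0, ∃ δ > 0, ∀ β : ℝ → E, IsIntegralCurveOn β (fun _ => v) (Icc 0 T) →
      ∀ η, 0 < η → η < δ → ‖β 0 - α 0‖ ≤ η → ∀ s ∈ Icc 0 T, ‖β s - α s‖ ≤ C * η := by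
  have hαc : ContinuousOn α (Icc 0 T) := fun t ht => (hα t ht).continuousWithinAt
  obtain ⟨R, hR⟩ := (isCompact_Icc.image_of_continuousOn hαc).isBounded.subset_closedBall 0
  obtain ⟨L, hL⟩ := (isCompact_closedBall (0 : E) (R + 1)).exists_bound_of_continuousOn
    (hv.continuous_fderiv one_ne_zero).continuousOn
  have hLip : ∀ x ∈ Metric.closedBall (0 : E) (R + 1), ∀ y ∈ Metric.closedBall (0 : E) (R + 1),
      ‖v y - v x‖ ≤ L * ‖y - x‖ := fun x hx y hy =>
    (convex_closedBall (0 : E) (R + 1)).norm_image_sub_le_of_norm_fderiv_le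
      (fun z _ => (hv.differentiable one_ne_zero).differentiableAt) hL hx hy
  -- Strictly above `L`, since the comparison theorem needs a strict inequality of derivatives at
  -- contact.
  set K : ℝ := |L| + 1
  have hK : 0 < K := by positivity
  -- This `δ` keeps the barrier `exp (K s) η` at most `1`, so at a contact time `β s` lies in the
  -- ball of radius `R + 1` where `L` is valid.
  refine ⟨Real.exp (K * T), Real.exp_pos _, Real.exp (-(K * T)), Real.exp_pos _, ?_⟩
  intro β hβ η hη hηδ h0
  have hβc : ContinuousOn β (Icc 0 T) := fun t ht => (hβ t ht).continuousWithinAt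
  have hder : ∀ γ : ℝ → E, IsIntegralCurveOn γ (fun _ => v) (Icc 0 T) →
      ∀ s ∈ Ico 0 T, HasDerivWithinAt γ (v (γ s)) (Ici s) s := fun γ hγ s hs =>
    ((hγ s (Ico_subset_Icc_self hs)).mono (Icc_subset_Icc_left hs.1)).mono_of_mem_nhdsWithin
      (Icc_mem_nhdsGE hs.2)
  have hexp : ∀ s ≤ T, Real.exp (K * s) * η ≤ Real.exp (K * T) * η := fun s hs => by gcongr
  have hfin : Real.exp (K * T) * η ≤ 1 := by
    rw [Real.exp_neg] at hηδ
    have := mul_le_mul_of_nonneg_left hηδ.le (Real.exp_pos (K * T)).le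
    rwa [mul_inv_cancel₀ (Real.exp_pos _).ne'] at this
  have key := image_norm_le_of_norm_deriv_right_lt_deriv_boundary (f := fun s => β s - α s)
    (f' := fun s => v (β s) - v (α s)) (a := 0) (b := T) (hβc.sub hαc)
    (fun s hs => (hder β hβ s hs).sub (hder α hα s hs))
    (B := fun s => Real.exp (K * s) * η) (B' := fun s => Real.exp (K * s) * K * η)
    (by simpa using h0)
    (fun s => by
      have := (((hasDerivAt_id s).const_mul K).exp).mul_const η
      simpa using this)
    (fun s hs hs' => by
      have hαs : α s ∈ Metric.closedBall (0 : E) R := hR ⟨s, Ico_subset_Icc_self hs, rfl⟩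
      rw [mem_closedBall_zero_iff] at hαs
      have hβs : ‖β s‖ ≤ R + 1 := by
        calc ‖β s‖ = ‖α s + (β s - α s)‖ := by congr 1; abel
          _ ≤ ‖α s‖ + ‖β s - α s‖ := norm_add_le _ _
          _ ≤ R + 1 := add_le_add hαs (hs'.le.trans ((hexp s hs.2.le).trans hfin))
      have h1 := hLip (α s) (by rw [mem_closedBall_zero_iff]; linarith) (β s)
        (by rwa [mem_closedBall_zero_iff])
      have hpos : 0 < Real.exp (K * s) * η := by positivity
      rw [hs'] at h1
      calc ‖v (β s) - v (α s)‖ ≤ L * (Real.exp (K * s) * η) := h1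
        _ < K * (Real.exp (K * s) * η) :=
          mul_lt_mul_of_pos_right ((le_abs_self L).trans_lt (lt_add_one _)) hpos
        _ = Real.exp (K * s) * K * η := by ring)
  intro s hs
  exact (key hs).trans (hexp s hs.2)

theorem IsIntegralCurveOn.eq_of_eq_zero {E : Type*} [NormedAddCommGroup E] [NormedSpace ℝ E]
    [ProperSpace E] {v : E → E} (hv : ContDiff ℝ 1 v) {α β : ℝ → E}
    (hα : IsIntegralCurveOn α (fun _ => v) (Ici 0))
    (hβ : IsIntegralCurveOn β (fun _ => v) (Ici 0)) (h0 : β 0 = α 0) {t : ℝ} (ht : 0 ≤ t) :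
    β t = α t := by
  obtain ⟨C, hC, δ, hδ, h⟩ := exists_dist_le_of_isIntegralCurveOn hv
    (hα.mono (s' := Icc 0 t) Icc_subset_Ici_self)
  rw [← sub_eq_zero, ← norm_le_zero_iff]
  have hlim : Tendsto (fun η : ℝ => C * η) (𝓝[>] 0) (𝓝 0) := by
    have : Tendsto (fun η : ℝ => C * η) (𝓝 0) (𝓝 (C * 0)) := (continuous_const_mul C).tendsto 0
    rw [mul_zero] at this
    exact this.mono_left nhdsWithin_le_nhds
  refine ge_of_tendsto hlim ?_
  filter_upwards [Ioo_mem_nhdsGT hδ] with η hη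
  exact h β (hβ.mono Icc_subset_Ici_self) η hη.1 hη.2 (by simp [h0, hη.1.le]) t ⟨ht, le_rfl⟩

/-- Reversing time along an integral curve. -/
theorem isIntegralCurveOn_reverse {E : Type*} [NormedAddCommGroup E] [NormedSpace ℝ E]
    {v : E → E} {γ : ℝ → E} (hγ : IsIntegralCurveOn γ (fun _ => v) (Ici 0)) {t₀ t : ℝ}
    (h : t₀ ≤ t) : IsIntegralCurveOn (fun s => γ (t - s)) (fun _ x => -v x) (Icc 0 t₀) := by
  intro s hs
  have h1 : HasDerivWithinAt (fun s : ℝ => t - s) (-1) (Icc 0 t₀) s :=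
    (hasDerivAt_id s).const_sub t |>.hasDerivWithinAt
  have h2 := HasDerivWithinAt.scomp s
    (hγ (t - s) (by simp only [mem_Ici]; linarith [hs.2])) h1
    (fun r hr => by simp only [mem_Ici]; linarith [hr.2])
  simpa [Function.comp_def] using h2

/-- A late return `γ b` close to `γ t₀`, flowed backwards for time `t₀`, gives a late return close
to `γ 0`. Hence a trajectory that meets its `ω`-limit set starts in it. -/
theorem mapClusterPt_zero_of_mapClusterPt {E : Type*} [NormedAddCommGroup E] [NormedSpace ℝ E]
    [ProperSpace E] {v : E → E} (hv : ContDiff ℝ 1 v) {γ : ℝ → E}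
    (hγ : IsIntegralCurveOn γ (fun _ => v) (Ici 0)) {t₀ : ℝ} (ht₀ : 0 ≤ t₀)
    (h : MapClusterPt (γ t₀) atTop γ) : MapClusterPt (γ 0) atTop γ := by
  obtain ⟨C, hC, δ, hδ, hdep⟩ := exists_dist_le_of_isIntegralCurveOn hv.neg
    (isIntegralCurveOn_reverse hγ (le_refl t₀))
  rw [mapClusterPt_iff_frequently]
  intro s hs
  obtain ⟨ε, hε, hεs⟩ := Metric.mem_nhds_iff.1 hs
  rw [frequently_atTop]
  intro a
  set η := min (δ / 2) (ε / (2 * C))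
  have hη : 0 < η := by positivity
  obtain ⟨b, hb, hbη⟩ := frequently_atTop.1
    (mapClusterPt_iff_frequently.1 h _ (Metric.ball_mem_nhds _ hη)) (max t₀ (a + t₀))
  refine ⟨b - t₀, by linarith [(le_max_right _ _).trans hb], hεs ?_⟩
  have := hdep _ (isIntegralCurveOn_reverse hγ ((le_max_left _ _).trans hb)) η hη
    ((min_le_left _ _).trans_lt (half_lt_self hδ))
    (by simpa [dist_eq_norm] using (Metric.mem_ball.1 hbη).le) t₀ ⟨ht₀, le_rfl⟩
  rw [Metric.mem_ball, dist_eq_norm]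
  simp only [sub_self] at this
  calc _ ≤ C * η := this
    _ ≤ C * (ε / (2 * C)) := by gcongr; exact min_le_right _ _
    _ = ε / 2 := by field_simp
    _ < ε := half_lt_self hε

/-- A trajectory starting in an open set whose frontier is the `ω`-limit set of the starting point
never leaves the open set. -/
theorem exists_integralCurve_mem {n : ℕ} {F : EuclideanSpace ℝ (Fin n) → EuclideanSpace ℝ (Fin n)}
    (hF : ContDiff ℝ 1 F) {D : Set (EuclideanSpace ℝ (Fin n))} (hD : IsOpen D)
    {x : EuclideanSpace ℝ (Fin n)} (hx : x ∈ D) (hω : omegaLimitSet F x = frontier D)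
    (hne : (frontier D).Nonempty) :
    ∃ γ : ℝ → EuclideanSpace ℝ (Fin n), IsIntegralCurveOn γ (fun _ => F) (Ici 0) ∧
      (∀ t ≥ 0, γ t ∈ D) ∧ ∀ y ∈ frontier D, MapClusterPt y atTop γ := by
  obtain ⟨y₀, hy₀⟩ := hne
  rw [← hω] at hy₀
  obtain ⟨γ, hγ0, hγ, -⟩ := hy₀
  -- Each limit point comes with its own solution; uniqueness identifies them all with `γ`.
  have hclus : ∀ y ∈ frontier D, MapClusterPt y atTop γ := by
    intro y hy
    rw [← hω] at hy
    obtain ⟨β, hβ0, hβ, hyβ⟩ := hy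
    have heq : β =ᶠ[atTop] γ := by
      filter_upwards [eventually_ge_atTop 0] with t ht
      exact IsIntegralCurveOn.eq_of_eq_zero hF hγ hβ (hβ0.trans hγ0.symm) ht
    rwa [MapClusterPt, ← Filter.map_congr heq]
  have hnot : ∀ t ≥ 0, γ t ∉ frontier D := by
    intro t ht hmem
    have : x ∈ frontier D := by
      rw [← hω]
      exact ⟨γ, hγ0, hγ, hγ0 ▸ mapClusterPt_zero_of_mapClusterPt hF hγ ht (hclus _ hmem)⟩
    rw [hD.frontier_eq] at this
    exact this.2 hx
  refine ⟨γ, hγ, ?_, hclus⟩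
  have hγc : ContinuousOn γ (Ici 0) := fun t ht => (hγ t ht).continuousWithinAt
  have hpre : IsPreconnected (γ '' Ici 0) := isPreconnected_Ici.image γ hγc
  have hsub : γ '' Ici 0 ⊆ D := by
    refine hpre.subset_left_of_subset_union hD isClosed_closure.isOpen_compl
      (disjoint_compl_right_iff_subset.2 subset_closure) ?_ ⟨x, ⟨0, self_mem_Ici, hγ0⟩, hx⟩
    rintro _ ⟨t, ht, rfl⟩
    by_cases hc : γ t ∈ closure D
    · left
      by_contra hn
      exact hnot t ht (by rw [hD.frontier_eq]; exact ⟨hc, hn⟩)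
    · exact Or.inr hc
  exact fun t ht => hsub ⟨t, ht, rfl⟩

end PlanarHHD

/-! ### Gradients on the closure, and their vanishing on the `ω`-limit set. -/

namespace PlanarHHD

/-- Supplies the limits without which `extendFrom` in `gradOnClosure` would carry no information. -/
theorem IsCkOnClosure.exists_continuousOn_eq_gradient {n k : ℕ} {V : EuclideanSpace ℝ (Fin n) → ℝ}
    {D : Set (EuclideanSpace ℝ (Fin n))} (h : IsCkOnClosure k V D) (hk : 1 ≤ k) :
    ∃ G : EuclideanSpace ℝ (Fin n) → EuclideanSpace ℝ (Fin n),
      ContinuousOn G (closure D) ∧ ∀ x ∈ D, G x = gradient V x := by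
  obtain ⟨g, hg, hgD⟩ := h.2.2 1 hk
  refine ⟨fun y => (InnerProductSpace.toDual ℝ _).symm
    (continuousMultilinearCurryFin1 ℝ (EuclideanSpace ℝ (Fin n)) ℝ (g y)), ?_, fun x hx => ?_⟩
  · exact (LinearIsometryEquiv.continuous _).comp_continuousOn
      ((LinearIsometryEquiv.continuous _).comp_continuousOn hg)
  · simp only [gradient, hgD x hx]
    congr 1
    ext v
    simp

theorem IsCkOnClosure.continuousOn_gradOnClosure {n k : ℕ} {V : EuclideanSpace ℝ (Fin n) → ℝ}
    {D : Set (EuclideanSpace ℝ (Fin n))} (h : IsCkOnClosure k V D) (hk : 1 ≤ k) :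
    ContinuousOn (gradOnClosure D V) (closure D) := by
  obtain ⟨G, hG, hGD⟩ := h.exists_continuousOn_eq_gradient hk
  refine continuousOn_extendFrom subset_rfl fun x hx => ⟨G x, ?_⟩
  refine ((hG x hx).mono subset_closure).congr' ?_
  filter_upwards [self_mem_nhdsWithin] with y hy using hGD y hy

theorem IsCkOnClosure.gradOnClosure_eq {n k : ℕ} {V : EuclideanSpace ℝ (Fin n) → ℝ}
    {D : Set (EuclideanSpace ℝ (Fin n))} (h : IsCkOnClosure k V D) (hk : 1 ≤ k)
    {x : EuclideanSpace ℝ (Fin n)} (hx : x ∈ D) : gradOnClosure D V x = gradient V x := by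
  obtain ⟨G, hG, hGD⟩ := h.exists_continuousOn_eq_gradient hk
  exact extendFrom_extends (((hG.mono subset_closure)).congr fun y hy => (hGD y hy).symm) x hx

theorem IsCkOnClosure.exists_norm_fderiv_le {E G : Type*} [NormedAddCommGroup E] [NormedSpace ℝ E]
    [NormedAddCommGroup G] [NormedSpace ℝ G] {k : ℕ} {f : E → G} {D : Set E}
    (h : IsCkOnClosure k f D) (hk : 1 ≤ k) {p : E} (hp : p ∈ closure D) :
    ∃ L, 0 ≤ L ∧ ∃ r > 0, ∀ x ∈ D ∩ Metric.ball p r, ‖fderiv ℝ f x‖ ≤ L := by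
  obtain ⟨g, hg, hgD⟩ := h.2.2 1 hk
  have hev : ∀ᶠ x in 𝓝[closure D] p, ‖g x‖ < ‖g p‖ + 1 :=
    (hg p hp).norm.eventually_lt_const (lt_add_one _)
  obtain ⟨r, hr, hsub⟩ := Metric.mem_nhdsWithin_iff.1 hev
  refine ⟨‖g p‖ + 1, by positivity, r, hr, fun x hx => ?_⟩
  have := hsub ⟨hx.2, subset_closure hx.1⟩
  simp only [mem_ofPred_eq, hgD x hx.1, norm_iteratedFDeriv_one] at this
  exact this.le

/-- The potential decreases along the flow at the rate `‖∇V‖ ^ 2`. -/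
theorem IsStrictlyOrthogonalHHD.hasDerivAt_potential {n : ℕ}
    {F : EuclideanSpace ℝ (Fin n) → EuclideanSpace ℝ (Fin n)}
    {D : Set (EuclideanSpace ℝ (Fin n))} {V : EuclideanSpace ℝ (Fin n) → ℝ}
    {u : EuclideanSpace ℝ (Fin n) → EuclideanSpace ℝ (Fin n)}
    (h : IsStrictlyOrthogonalHHD F D V u) (hD : IsOpen D) {γ : ℝ → EuclideanSpace ℝ (Fin n)}
    {t : ℝ} (ht : γ t ∈ D) (hγ : HasDerivAt γ (F (γ t)) t) :
    HasDerivAt (fun s => V (γ s)) (-‖gradOnClosure D V (γ t)‖ ^ 2) t := by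
  have hV : DifferentiableAt ℝ V (γ t) :=
    (h.potential_C3.1.contDiffAt (hD.mem_nhds ht)).differentiableAt (by norm_num)
  have h1 := hV.hasFDerivAt.comp_hasDerivAt t hγ
  have hmem := subset_closure ht
  have h2 : fderiv ℝ V (γ t) (F (γ t)) = -‖gradOnClosure D V (γ t)‖ ^ 2 := by
    rw [← toDual_gradient, InnerProductSpace.toDual_apply_apply,
      ← h.potential_C3.gradOnClosure_eq (by norm_num) ht, h.decomposition _ hmem, inner_add_right,
      inner_neg_right, real_inner_comm (u _), h.orthogonal _ hmem, real_inner_self_eq_norm_sq,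
      add_zero]
  rwa [h2] at h1

/-- The gradient of the potential vanishes at the `ω`-limit points of a trajectory in `D`. -/
theorem IsStrictlyOrthogonalHHD.gradOnClosure_eq_zero {n : ℕ}
    {F : EuclideanSpace ℝ (Fin n) → EuclideanSpace ℝ (Fin n)} (hF : Continuous F)
    {D : Set (EuclideanSpace ℝ (Fin n))} {V : EuclideanSpace ℝ (Fin n) → ℝ}
    {u : EuclideanSpace ℝ (Fin n) → EuclideanSpace ℝ (Fin n)}
    (h : IsStrictlyOrthogonalHHD F D V u) (hD : IsOpen D) {γ : ℝ → EuclideanSpace ℝ (Fin n)}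
    (hγ : IsIntegralCurveOn γ (fun _ => F) (Ici 0)) (hγD : ∀ t ≥ 0, γ t ∈ D)
    {y : EuclideanSpace ℝ (Fin n)} (hy : y ∈ closure D) (hyγ : MapClusterPt y atTop γ) :
    gradOnClosure D V y = 0 := by
  by_contra hne
  set a := ‖gradOnClosure D V y‖ with ha
  have hapos : 0 < a := norm_pos_iff.2 hne
  have hγd : ∀ t > 0, HasDerivAt γ (F (γ t)) t := fun t ht =>
    (hγ t ht.le).hasDerivAt (Ici_mem_nhds ht)
  have hVd := fun t (ht : t > 0) => h.hasDerivAt_potential hD (hγD t ht.le) (hγd t ht)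
  have hVcont : ContinuousOn (fun s => V (γ s)) (Ioi 0) := fun t ht =>
    (hVd t ht).continuousAt.continuousWithinAt
  have hanti : AntitoneOn (fun s => V (γ s)) (Ioi 0) := by
    refine antitoneOn_of_deriv_nonpos (convex_Ioi 0) hVcont ?_ ?_
    · rw [interior_Ioi]
      exact fun t ht => (hVd t ht).differentiableAt.differentiableWithinAt
    · rw [interior_Ioi]
      intro t ht
      rw [(hVd t ht).deriv]
      exact neg_nonpos.2 (sq_nonneg _)
  have hVy : ∀ ε > 0, ∃ r > 0, ∀ z ∈ closure D ∩ Metric.ball y r, |V z - V y| < ε := by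
    intro ε hε
    obtain ⟨r, hr, hr'⟩ := Metric.continuousOn_iff.1 h.potential_C3.2.1 y hy ε hε
    exact ⟨r, hr, fun z hz => hr' z hz.1 hz.2⟩
  have hvisit : ∀ r > 0, ∀ b, ∃ t ≥ b, γ t ∈ Metric.ball y r := fun r hr =>
    frequently_atTop.1 (mapClusterPt_iff_frequently.1 hyγ _ (Metric.ball_mem_nhds y hr))
  -- Later visits near `y` bring `V` close to `V y`, and `V` only decreases.
  have hlow : ∀ t > 0, V y ≤ V (γ t) := by
    intro t ht
    refine le_of_forall_pos_le_add fun ε hε => ?_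
    obtain ⟨r, hr, hrV⟩ := hVy ε hε
    obtain ⟨s, hs, hsr⟩ := hvisit r hr t
    have h1 := abs_lt.1 (hrV _ ⟨subset_closure (hγD s (ht.le.trans hs)), hsr⟩)
    have h2 : V (γ s) ≤ V (γ t) := hanti ht (ht.trans_le hs) hs
    linarith
  obtain ⟨r₁, hr₁, hG⟩ : ∃ r > 0, ∀ z ∈ closure D ∩ Metric.ball y r,
      a / 2 < ‖gradOnClosure D V z‖ := by
    have hev : ∀ᶠ z in 𝓝[closure D] y, a / 2 < ‖gradOnClosure D V z‖ :=
      (h.potential_C3.continuousOn_gradOnClosure (by norm_num) y hy).norm.eventually_const_lt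
        (half_lt_self hapos)
    obtain ⟨r, hr, hsub⟩ := Metric.mem_nhdsWithin_iff.1 hev
    exact ⟨r, hr, fun z hz => hsub ⟨hz.2, hz.1⟩⟩
  obtain ⟨r₂, hr₂, hFb⟩ : ∃ r > 0, ∀ z ∈ Metric.ball y r, ‖F z‖ < ‖F y‖ + 1 :=
    Metric.mem_nhds_iff.1 (hF.norm.continuousAt.eventually_lt_const (lt_add_one ‖F y‖))
  set M := ‖F y‖ + 1
  have hM : 0 < M := by positivity
  set r := min r₁ r₂ / 3
  have hr : 0 < r := by positivity
  have hr1 : 2 * r < r₁ := by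
    have := min_le_left r₁ r₂
    simp only [r] at hr ⊢
    linarith
  have hr2 : 2 * r < r₂ := by
    have := min_le_right r₁ r₂
    simp only [r] at hr ⊢
    linarith
  -- At speed below `M`, a curve starting within `r` of `y` stays within `2 * r` for time `τ`.
  set τ := r / M
  have hτ : 0 < τ := by positivity
  have hstay : ∀ t > 0, γ t ∈ Metric.ball y r → ∀ s ∈ Icc t (t + τ), ‖γ s - y‖ ≤ 2 * r := by
    intro t ht htr s hs
    have hB : ∀ s ≤ t + τ, r + M * (s - t) ≤ 2 * r := by
      intro s hs
      have : M * (s - t) ≤ M * τ := by gcongr; linarith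
      have h2 : M * τ = r := by simp only [τ]; field_simp
      linarith
    have key := image_norm_le_of_norm_deriv_right_lt_deriv_boundary (f := fun s => γ s - y)
      (f' := fun s => F (γ s)) (a := t) (b := t + τ)
      (fun s hs => ((hγd s (ht.trans_le hs.1)).continuousAt.continuousWithinAt).sub
        continuousWithinAt_const)
      (fun s hs => ((hγd s (ht.trans_le hs.1)).hasDerivWithinAt.sub_const y))
      (B := fun s => r + M * (s - t)) (B' := fun _ => M)
      (by simpa [dist_eq_norm] using (Metric.mem_ball.1 htr).le)
      (fun s => by
        simpa using (((hasDerivAt_id s).sub_const t).const_mul M).const_add r)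
      (fun s hs hs' => hFb _ (by
        rw [Metric.mem_ball, dist_eq_norm, hs']
        exact (hB s hs.2.le).trans_lt hr2))
    exact (key hs).trans (hB s hs.2)
  -- The tolerance is the drop of `V` guaranteed over time `τ`, so one such visit pushes `V` below
  -- `V y`.
  obtain ⟨r₃, hr₃, hV₃⟩ := hVy (a ^ 2 / 4 * τ) (by positivity)
  obtain ⟨t, ht1, ht⟩ := hvisit (min r r₃) (by positivity) 1
  have ht0 : 0 < t := by linarith
  have htr : γ t ∈ Metric.ball y r := Metric.ball_subset_ball (min_le_left _ _) ht
  have hVt := abs_lt.1 (hV₃ (γ t) ⟨subset_closure (hγD t ht0.le),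
    Metric.ball_subset_ball (min_le_right _ _) ht⟩)
  have hdec : V (γ (t + τ)) - V (γ t) ≤ -(a ^ 2 / 4) * (t + τ - t) := by
    refine (convex_Icc t (t + τ)).image_sub_le_mul_sub_of_deriv_le
      (f := fun s => V (γ s)) (hVcont.mono fun s hs => ht0.trans_le hs.1) ?_ ?_ t
      ⟨le_rfl, by linarith⟩ (t + τ) ⟨by linarith, le_rfl⟩ (by linarith)
    · intro s hs
      rw [interior_Icc] at hs
      exact (hVd s (ht0.trans hs.1)).differentiableAt.differentiableWithinAt
    · intro s hs
      rw [interior_Icc] at hs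
      rw [(hVd s (ht0.trans hs.1)).deriv]
      have h1 := hG (γ s) ⟨subset_closure (hγD s (ht0.trans hs.1).le), by
        rw [Metric.mem_ball, dist_eq_norm]
        exact (hstay t ht0 htr s ⟨hs.1.le, hs.2.le⟩).trans_lt hr1⟩
      have h2 : (a / 2) ^ 2 ≤ ‖gradOnClosure D V (γ s)‖ ^ 2 := by gcongr
      linarith [h2, show (a / 2) ^ 2 = a ^ 2 / 4 by ring]
  have := hlow (t + τ) (by linarith)
  have h3 : -(a ^ 2 / 4) * (t + τ - t) = -(a ^ 2 / 4 * τ) := by ring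
  linarith [hVt.2]

end PlanarHHD

/-! ### Uniqueness for planar harmonic fields vanishing on the frontier. -/

namespace PlanarHHD

/-- A function on the closure of an open set that vanishes at the frontier and has bounded
derivative near `p ∉ D` is bounded near `p` by a multiple of the distance to `p`. -/
theorem norm_le_mul_of_eq_zero_on_frontier {E G : Type*} [NormedAddCommGroup E] [NormedSpace ℝ E]
    [NormedAddCommGroup G] [NormedSpace ℝ G] {f : E → G} {D : Set E} (hD : IsOpen D)
    (hf : DifferentiableOn ℝ f D) (hfc : ContinuousOn f (closure D))
    (hf0 : ∀ x ∈ frontier D, f x = 0) {p : E} (hp : p ∉ D) {L r : ℝ} (hL : 0 ≤ L)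
    (hb : ∀ x ∈ D ∩ Metric.ball p r, ‖fderiv ℝ f x‖ ≤ L) {q : E}
    (hq : q ∈ D ∩ Metric.ball p r) : ‖f q‖ ≤ L * ‖p - q‖ := by
  set l : ℝ → E := fun t => q + t • (p - q)
  have hlc : Continuous l := by fun_prop
  set S : Set ℝ := Icc 0 1 ∩ l ⁻¹' Dᶜ
  have hScl : IsClosed S := isClosed_Icc.inter (hD.isClosed_compl.preimage hlc)
  have hSne : S.Nonempty := ⟨1, ⟨zero_le_one, le_rfl⟩, by simpa [l] using hp⟩
  have hSbdd : BddBelow S := ⟨0, fun t ht => ht.1.1⟩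
  -- The segment may leave `D` before reaching `p`. Its first exit point lies on the frontier, where
  -- `f` vanishes, so the mean value inequality is applied only up to `T ≤ 1`.
  set T := sInf S
  have hTS : T ∈ S := hScl.csInf_mem hSne hSbdd
  have hlt : ∀ t ∈ Ico 0 T, l t ∈ D := by
    intro t ht
    by_contra hn
    exact (csInf_le hSbdd ⟨⟨ht.1, ht.2.le.trans hTS.1.2⟩, hn⟩).not_gt ht.2
  have hT0 : 0 < T := by
    refine lt_of_le_of_ne hTS.1.1 fun h0 => hTS.2 ?_
    rw [← h0]
    simpa [l] using hq.1
  have hTcl : l T ∈ closure D := by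
    have h1 : T ∈ closure (Ico 0 T) := by rw [closure_Ico hT0.ne]; exact ⟨hT0.le, le_rfl⟩
    exact closure_mono (image_subset_iff.2 hlt) (image_closure_subset_closure_image hlc ⟨T, h1, rfl⟩)
  have hmaps : MapsTo l (Icc 0 T) (closure D) := by
    intro t ht
    rcases ht.2.lt_or_eq with h | h
    · exact subset_closure (hlt t ⟨ht.1, h⟩)
    · rwa [h]
  have hld : ∀ t, HasDerivAt l (p - q) t := fun t => by
    simpa [l] using! ((hasDerivAt_id t).smul_const (p - q)).const_add q
  have key := norm_image_sub_le_of_norm_deriv_right_le_segment (f := f ∘ l)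
    (f' := fun t => fderiv ℝ f (l t) (p - q)) (a := 0) (b := T) (C := L * ‖p - q‖)
    (hfc.comp hlc.continuousOn hmaps)
    (fun t ht => (((hf.differentiableAt (hD.mem_nhds (hlt t ht))).hasFDerivAt).comp_hasDerivAt t
      (hld t)).hasDerivWithinAt)
    (fun t ht => by
      have hball : l t ∈ Metric.ball p r := by
        have hseg : l t ∈ segment ℝ q p := by
          rw [segment_eq_image']
          exact ⟨t, ⟨ht.1, ht.2.le.trans hTS.1.2⟩, rfl⟩
        have hr : 0 < r := (dist_nonneg).trans_lt (Metric.mem_ball.1 hq.2)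
        exact (convex_ball p r).segment_subset hq.2 (Metric.mem_ball_self hr) hseg
      exact ((fderiv ℝ f (l t)).le_opNorm _).trans
        (mul_le_mul_of_nonneg_right (hb _ ⟨hlt t ht, hball⟩) (norm_nonneg _)))
    T ⟨hT0.le, le_rfl⟩
  have hfT : f (l T) = 0 := hf0 _ (by rw [hD.frontier_eq]; exact ⟨hTcl, hTS.2⟩)
  have hl0 : l 0 = q := by simp [l]
  simp only [Function.comp_apply, hfT, hl0, zero_sub, norm_neg, sub_zero] at key
  refine key.trans (mul_le_of_le_one_right (by positivity) hTS.1.2)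

/-- A continuous injective arc accumulates at its starting point. -/
theorem IsPiecewiseC1JordanCurve.exists_accPt {J : Set (EuclideanSpace ℝ (Fin 2))}
    (hJ : IsPiecewiseC1JordanCurve J) : ∃ p ∈ J, ∃ᶠ z in 𝓝[≠] p, z ∈ J := by
  obtain ⟨γ, hγc, -, hγi, hγJ, -⟩ := hJ
  refine ⟨γ 0, hγJ ▸ ⟨0, by simp, rfl⟩, ?_⟩
  have h1 : Tendsto γ (𝓝[Ioo 0 1] 0) (𝓝[≠] (γ 0)) := by
    refine tendsto_nhdsWithin_iff.2 ⟨((hγc 0 (by simp)).mono Ioo_subset_Icc_self), ?_⟩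
    filter_upwards [self_mem_nhdsWithin] with t ht heq
    exact ht.1.ne' (hγi ⟨ht.1.le, ht.2⟩ (by simp) heq)
  have hne : (𝓝[Ioo (0 : ℝ) 1] 0).NeBot := by
    rw [nhdsWithin_Ioo_eq_nhdsGT one_pos]
    infer_instance
  refine h1.frequently (Eventually.frequently ?_)
  filter_upwards [self_mem_nhdsWithin] with t ht
  exact hγJ ▸ ⟨t, Ioo_subset_Icc_self ht, rfl⟩

/-- A planar field on an open set with bounded derivative near each frontier point which satisfies
the Cauchy--Riemann equations (in conjugate form) and vanishes on the frontier vanishes identically,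
as soon as the frontier has an accumulation point. -/
theorem eq_zero_of_divergence_eq_zero_of_symmetric {D : Set (EuclideanSpace ℝ (Fin 2))}
    (hD : IsOpen D) {H : EuclideanSpace ℝ (Fin 2) → EuclideanSpace ℝ (Fin 2)}
    (hH : DifferentiableOn ℝ H D) (hHc : ContinuousOn H (closure D))
    (hH0 : ∀ x ∈ frontier D, H x = 0)
    (hb : ∀ p ∈ closure D, ∃ L, 0 ≤ L ∧ ∃ r > 0, ∀ x ∈ D ∩ Metric.ball p r, ‖fderiv ℝ H x‖ ≤ L)
    (hdiv : ∀ x ∈ D, divergence H x = 0)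
    (hsymm : ∀ x ∈ D, fderiv ℝ H x (EuclideanSpace.single 0 1) 1 =
      fderiv ℝ H x (EuclideanSpace.single 1 1) 0)
    (hacc : ∃ p ∈ frontier D, ∃ᶠ z in 𝓝[≠] p, z ∈ frontier D) :
    ∀ x ∈ D, H x = 0 := by
  classical
  set e := Complex.orthonormalBasisOneI.repr with he
  set c : EuclideanSpace ℝ (Fin 2) →L[ℝ] ℂ :=
    (Complex.conjCLE : ℂ →L[ℝ] ℂ).comp (e.symm.toContinuousLinearEquiv : _ →L[ℝ] ℂ)
  have hc : ∀ v, c v = (v 0 : ℂ) - v 1 * Complex.I := fun v => by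
    simp [c, he, Complex.orthonormalBasisOneI_repr_symm_apply, sub_eq_add_neg]
  have hcn : ∀ v, ‖c v‖ = ‖v‖ := fun v => by simp [c]
  set g : ℂ → ℂ := fun z => if e z ∈ D then c (H (e z)) else 0
  have hgD : ∀ z, e z ∈ D → g z = c (H (e z)) := fun z hz => if_pos hz
  have hgn : ∀ z, e z ∉ D → g z = 0 := fun z hz => if_neg hz
  -- At a frontier point only `‖g w‖ ≤ L * ‖w - z‖` is known, which does not make `g`
  -- differentiable; squaring gives a quadratic bound, hence derivative `0`.
  have hdiff : Differentiable ℂ (fun z => g z ^ 2) := by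
    intro z
    by_cases hz : e z ∈ D
    · have hopen : e ⁻¹' D ∈ 𝓝 z := (hD.preimage e.continuous).mem_nhds hz
      have hev : g =ᶠ[𝓝 z] fun z => c (H (e z)) := by
        filter_upwards [hopen] with w hw using hgD w hw
      have hd : HasFDerivAt (fun z => c (H (e z)))
          (c.comp ((fderiv ℝ H (e z)).comp (e.toContinuousLinearEquiv : ℂ →L[ℝ] _))) z :=
        c.hasFDerivAt.comp z ((hH.differentiableAt (hD.mem_nhds hz)).hasFDerivAt.comp z
          e.toContinuousLinearEquiv.hasFDerivAt)
      have he1 : e 1 = EuclideanSpace.single 0 1 := by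
        ext i; fin_cases i <;> simp [he, Complex.orthonormalBasisOneI_repr_apply]
      have heI : e Complex.I = EuclideanSpace.single 1 1 := by
        ext i; fin_cases i <;> simp [he, Complex.orthonormalBasisOneI_repr_apply]
      have hg : DifferentiableAt ℂ g z := by
        refine DifferentiableAt.congr_of_eventuallyEq ?_ hev
        rw [differentiableAt_complex_iff_differentiableAt_real]
        refine ⟨hd.differentiableAt, ?_⟩
        have h1 := hsymm _ hz
        have h2 := hdiv _ hz
        simp only [divergence, Fin.sum_univ_two] at h2
        rw [hd.fderiv]
        simp only [ContinuousLinearMap.comp_apply, ContinuousLinearEquiv.coe_coe,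
          LinearIsometryEquiv.coe_toContinuousLinearEquiv, he1, heI, hc, smul_eq_mul]
        -- The conjugation in `c` turns zero curl and zero divergence into the Cauchy–Riemann
        -- equations.
        rw [← h1, eq_neg_of_add_eq_zero_left h2]
        push_cast
        linear_combination
          ((fderiv ℝ H (e z) (EuclideanSpace.single 0 1) 1 : ℝ) : ℂ) * Complex.I_sq
      exact hg.pow 2
    · have hgz := hgn z hz
      obtain ⟨L, hL, hbound⟩ : ∃ L, 0 ≤ L ∧ ∀ᶠ w in 𝓝 z, ‖g w‖ ≤ L * ‖w - z‖ := by
        by_cases hcl : e z ∈ closure D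
        · obtain ⟨L, hL, r, hr, hbr⟩ := hb _ hcl
          refine ⟨L, hL, ?_⟩
          filter_upwards [Metric.ball_mem_nhds z hr] with w hw
          by_cases hwD : e w ∈ D
          · have := norm_le_mul_of_eq_zero_on_frontier hD hH hHc hH0 hz hL hbr
              ⟨hwD, by simpa [Metric.mem_ball] using hw⟩
            rwa [← map_sub, LinearIsometryEquiv.norm_map, norm_sub_rev, ← hcn, ← hgD w hwD] at this
          · rw [hgn w hwD, norm_zero]
            positivity
        · refine ⟨0, le_rfl, ?_⟩
          filter_upwards [(isClosed_closure.isOpen_compl.preimage e.continuous).mem_nhds hcl]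
            with w hw
          rw [hgn w fun hwD => hw (subset_closure hwD)]
          simp
      have hlim : HasDerivAt (fun w => g w ^ 2) 0 z := by
        rw [hasDerivAt_iff_isLittleO]
        have h1 : (fun w => g w ^ 2) =O[𝓝 z] fun w => ‖w - z‖ ^ 2 := by
          refine Asymptotics.IsBigO.of_bound (L ^ 2) ?_
          filter_upwards [hbound] with w hw
          rw [norm_pow, norm_pow, norm_norm, ← mul_pow]
          gcongr
        have h2 : (fun w => ‖w - z‖ ^ 2) =o[𝓝 z] fun w => w - z :=
          Asymptotics.isLittleO_pow_sub_sub z one_lt_two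
        simpa [hgz] using h1.trans_isLittleO h2
      exact hlim.differentiableAt
  obtain ⟨p, hp, hpacc⟩ := hacc
  have hzero : ∀ y ∈ frontier D, y ∉ D := fun y hy hyD => by
    rw [hD.frontier_eq] at hy
    exact hy.2 hyD
  have hfreq : ∃ᶠ z in 𝓝[≠] (e.symm p), g z ^ 2 = 0 := by
    have ht : Tendsto e.symm (𝓝[≠] p) (𝓝[≠] (e.symm p)) :=
      e.symm.continuous.continuousAt.continuousWithinAt.tendsto_nhdsWithin
        fun y hy h => hy (e.symm.injective h)
    refine ht.frequently (hpacc.mono fun y hy => ?_)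
    rw [hgn _ (by simpa using hzero y hy)]
    simp
  have hall := AnalyticOnNhd.eqOn_zero_of_preconnected_of_frequently_eq_zero
    (U := univ) (fun z _ => hdiff.analyticAt z) isPreconnected_univ (mem_univ _) hfreq
  intro x hx
  have h1 : g (e.symm x) ^ 2 = 0 := hall (mem_univ _)
  rw [pow_eq_zero_iff two_ne_zero, hgD _ (by simpa using hx)] at h1
  rw [LinearIsometryEquiv.apply_symm_apply] at h1
  rw [← norm_eq_zero, ← hcn, h1, norm_zero]

/-- The Jacobian of a gradient field is symmetric. -/
theorem inner_fderiv_comm_of_eventuallyEq_gradient {E : Type*} [NormedAddCommGroup E]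
    [InnerProductSpace ℝ E] [CompleteSpace E] {w : E → ℝ} {H : E → E} {x : E}
    (hw : ContDiffAt ℝ 2 w x) (hH : DifferentiableAt ℝ H x) (hev : H =ᶠ[𝓝 x] gradient w)
    (a b : E) : inner ℝ (fderiv ℝ H x a) b = inner ℝ (fderiv ℝ H x b) a := by
  have hd : DifferentiableAt ℝ (fderiv ℝ w) x :=
    (hw.fderiv_right (m := 1) (by norm_num)).differentiableAt one_ne_zero
  have key : ∀ a b, inner ℝ (fderiv ℝ H x a) b = fderiv ℝ (fderiv ℝ w) x a b := by
    intro a b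
    have h1 : (fun y => inner ℝ (H y) b) =ᶠ[𝓝 x] fun y => fderiv ℝ w y b := by
      filter_upwards [hev] with y hy
      rw [hy, ← toDual_gradient, InnerProductSpace.toDual_apply_apply]
    have h2 := congrArg (fun f : E →L[ℝ] ℝ => f a) h1.fderiv_eq
    have h3 := (hd.hasFDerivAt.clm_apply (hasFDerivAt_const b x)).fderiv
    simpa [fderiv_inner_apply ℝ hH (differentiableAt_const b), h3] using h2
  rw [key, key]
  exact (hw.isSymmSndFDerivAt (by simp)).eq a b

end PlanarHHD

/-! ### Comparison of two decompositions. -/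

open PlanarHHD in
theorem mainTheorem6
    (F : EuclideanSpace ℝ (Fin 2) → EuclideanSpace ℝ (Fin 2)) (hF : ContDiff ℝ 2 F)
    (D : Set (EuclideanSpace ℝ (Fin 2))) (hD_open : IsOpen D) (hD_conn : IsConnected D)
    (hD_bdry : PlanarHHD.IsPiecewiseC1JordanCurve (frontier D))
    (hω : ∃ x ∈ D, PlanarHHD.omegaLimitSet F x = frontier D)
    (V₁ V₂ : EuclideanSpace ℝ (Fin 2) → ℝ)
    (u₁ u₂ : EuclideanSpace ℝ (Fin 2) → EuclideanSpace ℝ (Fin 2))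
    (h₁ : PlanarHHD.IsStrictlyOrthogonalHHD F D V₁ u₁)
    (h₂ : PlanarHHD.IsStrictlyOrthogonalHHD F D V₂ u₂) :
    (∀ y ∈ closure D, u₁ y = u₂ y) ∧
    (∀ y ∈ closure D, PlanarHHD.gradOnClosure D V₁ y = PlanarHHD.gradOnClosure D V₂ y) ∧
    (∃ c : ℝ, ∀ y ∈ closure D, V₁ y = V₂ y + c) := by
  obtain ⟨p, hp, hacc⟩ := hD_bdry.exists_accPt
  obtain ⟨x, hx, hωx⟩ := hω
  obtain ⟨γ, hγ, hγD, hclus⟩ :=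
    exists_integralCurve_mem (hF.of_le one_le_two) hD_open hx hωx ⟨p, hp⟩
  have hzero : ∀ {V u}, IsStrictlyOrthogonalHHD F D V u → ∀ y ∈ frontier D,
      gradOnClosure D V y = 0 := fun h y hy =>
    h.gradOnClosure_eq_zero hF.continuous hD_open hγ hγD (frontier_subset_closure hy) (hclus y hy)
  -- `F` cancels, so the divergence-free difference is also a gradient.
  have hgrad : ∀ y ∈ closure D, u₁ y - u₂ y = gradOnClosure D V₁ y - gradOnClosure D V₂ y := by
    intro y hy
    have h := (h₁.decomposition y hy).symm.trans (h₂.decomposition y hy)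
    rw [sub_eq_sub_iff_add_eq_add]
    rw [neg_add_eq_iff_eq_add] at h
    rw [h]
    abel
  have hVd : ∀ {V u}, IsStrictlyOrthogonalHHD F D V u → ∀ y ∈ D, ContDiffAt ℝ 3 V y :=
    fun h y hy => h.potential_C3.1.contDiffAt (hD_open.mem_nhds hy)
  have hud : ∀ {V u}, IsStrictlyOrthogonalHHD F D V u → ∀ y ∈ D, DifferentiableAt ℝ u y :=
    fun h y hy => (h.field_C2.1.contDiffAt (hD_open.mem_nhds hy)).differentiableAt (by norm_num)
  have hgw : ∀ y ∈ D, u₁ y - u₂ y = gradient (V₁ - V₂) y := by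
    intro y hy
    rw [hgrad y (subset_closure hy), h₁.potential_C3.gradOnClosure_eq (by norm_num) hy,
      h₂.potential_C3.gradOnClosure_eq (by norm_num) hy]
    simp only [gradient]
    rw [fderiv_sub ((hVd h₁ y hy).differentiableAt (by norm_num))
      ((hVd h₂ y hy).differentiableAt (by norm_num)), map_sub]
  have hfd : ∀ y ∈ D, fderiv ℝ (u₁ - u₂) y = fderiv ℝ u₁ y - fderiv ℝ u₂ y := fun y hy =>
    fderiv_sub (hud h₁ y hy) (hud h₂ y hy)
  have hH : ∀ y ∈ D, (u₁ - u₂) y = 0 := by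
    refine eq_zero_of_divergence_eq_zero_of_symmetric hD_open
      (fun y hy => ((hud h₁ y hy).sub (hud h₂ y hy)).differentiableWithinAt)
      (h₁.field_C2.2.1.sub h₂.field_C2.2.1) ?_ ?_ ?_ ?_ ⟨p, hp, hacc⟩
    · intro y hy
      rw [Pi.sub_apply, hgrad y (frontier_subset_closure hy), hzero h₁ y hy, hzero h₂ y hy, sub_zero]
    · intro y hy
      obtain ⟨L₁, hL₁, r₁, hr₁, hb₁⟩ := h₁.field_C2.exists_norm_fderiv_le (by norm_num) hy
      obtain ⟨L₂, hL₂, r₂, hr₂, hb₂⟩ := h₂.field_C2.exists_norm_fderiv_le (by norm_num) hy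
      refine ⟨L₁ + L₂, add_nonneg hL₁ hL₂, min r₁ r₂, lt_min hr₁ hr₂, fun z hz => ?_⟩
      rw [hfd z hz.1]
      exact (norm_sub_le _ _).trans (add_le_add
        (hb₁ z ⟨hz.1, Metric.ball_subset_ball (min_le_left _ _) hz.2⟩)
        (hb₂ z ⟨hz.1, Metric.ball_subset_ball (min_le_right _ _) hz.2⟩))
    · intro y hy
      have e₁ := h₁.divergence_free y hy
      have e₂ := h₂.divergence_free y hy
      simp only [divergence, hfd y hy] at *
      simp [e₁, e₂]
    · intro y hy
      have hev : (u₁ - u₂) =ᶠ[𝓝 y] gradient (V₁ - V₂) := by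
        filter_upwards [hD_open.mem_nhds hy] with z hz using hgw z hz
      have := inner_fderiv_comm_of_eventuallyEq_gradient (((hVd h₁ y hy).sub (hVd h₂ y hy)).of_le
        (by norm_num : (2 : WithTop ℕ∞) ≤ 3)) ((hud h₁ y hy).sub (hud h₂ y hy)) hev
        (EuclideanSpace.single 0 1) (EuclideanSpace.single 1 1)
      rwa [EuclideanSpace.inner_single_right, EuclideanSpace.inner_single_right, one_mul,
        one_mul] at this
  have hu : ∀ y ∈ closure D, u₁ y = u₂ y := fun y hy =>
    EqOn.of_subset_closure (fun z hz => sub_eq_zero.1 (hH z hz)) h₁.field_C2.2.1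
      h₂.field_C2.2.1 subset_closure subset_rfl hy
  refine ⟨hu, fun y hy => ?_, ?_⟩
  · rw [← sub_eq_zero, ← hgrad y hy, hu y hy, sub_self]
  -- Connectedness of `D` enters only here; the identity theorem was applied on all of `ℂ`.
  · obtain ⟨c, hc⟩ := hD_open.exists_is_const_of_fderiv_eq_zero (𝕜 := ℝ) (f := V₁ - V₂)
      hD_conn.isPreconnected
      (fun y hy => (((hVd h₁ y hy).sub (hVd h₂ y hy)).differentiableAt
        (by norm_num)).differentiableWithinAt)
      (fun y hy => by
        rw [← toDual_gradient, ← hgw y hy, hu y (subset_closure hy), sub_self, map_zero]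
        rfl)
    refine ⟨c, EqOn.of_subset_closure (s := D) (fun z hz => ?_) h₁.potential_C3.2.1
      (h₂.potential_C3.2.1.add continuousOn_const) subset_closure subset_rfl⟩
    have := hc z hz
    rw [Pi.sub_apply, sub_eq_iff_eq_add] at this
    rw [this, add_comm]
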